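/- For a Borel probability measure $\mu$ on $\mathbb{R}^d$ and $t \ge 0$ let \[ W_t^{\mu}=\{\,x\in\mathbb{R}^d : \text{there is a closed halfspace } h \text{ with } x\in h \text{ and } \mu(h)\le t\,\},\qquad w^{\mu}(t)=\mu(W_t^{\mu}). \] Let $P_n^{\mu}$ be the convex hull of $n$ independent random points with distribution $\mu$, and let $f_0(P_n^{\mu})$ be its number of vertices. Call $\mu$ non-atomic if $\mu(\{x\})=0$ for every $x\in\mathbb{R}^d$. (i) For every $d$ there is a sequence $\varepsilon_d(n)$ of real numbers, depending only on $d$ and $n$ (not on $\mu$), with $\varepsilon_d(n)\to 0$ as $n\to\infty$, such that for every non-atomic Borel probability measure $\mu$ on $\mathbb{R}^d$ and every $n\ge 1$, \[ \frac1e\, n\, w^{\mu}\!\left(\tfrac1n\right)\ \le\ \mathbb{E}\left[f_0(P_n^{\mu})\right]\ \le\ n\, w^{\mu}\!\left((d+2)\tfrac{\ln n}{n}\right)+\varepsilon_d(n). \] (ii) There exists a non-atomic Borel probability measure $\nu$ on $\mathbb{R}^2$ such that \[ \mathbb{E}\left[f_0(P_n^{\nu})\right] > \frac12\, n\, w^{\nu}\!\left(\tfrac{\log_2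 n}{n}\right) \] for infinitely many $n$. -/

import Mathlib

open MeasureTheory Filter Topology

noncomputable section

/-- A closed halfspace of `ℝ^d`: `{y | c ≤ ⟨a, y⟩}` with `a ≠ 0`. -/
def IsClosedHalfspace {d : ℕ} (h : Set (EuclideanSpace ℝ (Fin d))) : Prop :=
  ∃ a : EuclideanSpace ℝ (Fin d), a ≠ 0 ∧ ∃ c : ℝ, h = {y | c ≤ inner ℝ a y}

/-- The wet part `W_t^μ`: the points lying in some halfspace of `μ`-measure at most `t`. -/
def wetPart {d : ℕ} (μ : Measure (EuclideanSpace ℝ (Fin d))) (t : ℝ) :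
    Set (EuclideanSpace ℝ (Fin d)) :=
  {x | ∃ h, IsClosedHalfspace h ∧ x ∈ h ∧ μ.real h ≤ t}

/-- `w^μ(t) = μ(W_t^μ)`. -/
def wetMeasure {d : ℕ} (μ : Measure (EuclideanSpace ℝ (Fin d))) (t : ℝ) : ℝ :=
  μ.real (wetPart μ t)

/-- The polytope spanned by the sample points `x 0, …, x (n-1)`. -/
def samplePolytope {d n : ℕ} (x : Fin n → EuclideanSpace ℝ (Fin d)) :
    Set (EuclideanSpace ℝ (Fin d)) :=
  convexHull ℝ (Set.range x)

/-- `f_0(P)`: the number of vertices (extreme points) of a polytope `P`. -/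
def numVertices {d : ℕ} (P : Set (EuclideanSpace ℝ (Fin d))) : ℕ :=
  (P.extremePoints ℝ).ncard

/-- The law of a sample of `n` independent points with distribution `μ`. -/
def sampleLaw {d : ℕ} (μ : Measure (EuclideanSpace ℝ (Fin d))) (n : ℕ) :
    Measure (Fin n → EuclideanSpace ℝ (Fin d)) :=
  Measure.pi fun _ => μ

/-- `E[f_0(P_n^μ)]`. -/
def expectedVertices {d : ℕ} (μ : Measure (EuclideanSpace ℝ (Fin d))) (n : ℕ) : ℝ :=
  ∫ x, (numVertices (samplePolytope x) : ℝ) ∂(sampleLaw μ n)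

end

/-! If a polytope in `ℝ^d` spanned by sample points misses `y`, then its point nearest to `y` is
already in the convex hull of at most `d` of them, and all others avoid the closed halfspace with
`y` on its boundary that faces away from this nearest point. If `y` is outside the wet part `W_t`,
the halfspace has measure more than `t`, so a union bound over the choice of the `d` points makes
the event improbable. If `y` is in `W_t`, then a halfspace of measure at most `t` contains `y`, and
`n - 1` sample points all miss it with probability at least `(1 - t) ^ (n - 1)`. Efron's identity
turns both estimates into bounds on the number of vertices: `E[f_0]` is `n` times the probability
that one sample point is outside the convex hull of the others.

The counterexample is carried by the spheres of radii `2 ^ i`, with masses decreasing so fast that,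
for a suitable `n`, most samples of `n` points have no point beyond the `i`-th sphere, so that all
points on it are vertices, while the halfspaces meeting an inner sphere have measure more than
`log₂ n / n`. -/

section ConvexHull

open Set Metric

variable {ι E : Type*} [NormedAddCommGroup E] [NormedSpace ℝ E]

theorem convexHull_range_eq_image_stdSimplex [Fintype ι] (x : ι → E) :
    convexHull ℝ (range x) = (fun w : ι → ℝ => ∑ i, w i • x i) '' stdSimplex ℝ ι := by
  classical
  have hlin : (fun w : ι → ℝ => ∑ i, w i • x i) = Fintype.linearCombination ℝ x := rfl
  rw [hlin, ← convexHull_rangle_single_eq_stdSimplex, LinearMap.image_convexHull, ← range_comp]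
  congr 2 with i
  simp

theorem continuous_infDist_convexHull_range [Finite ι] :
    Continuous fun p : E × (ι → E) => infDist p.1 (convexHull ℝ (range p.2)) := by
  have := Fintype.ofFinite ι
  simp_rw [infDist_eq_iInf, ← sInf_image', convexHull_range_eq_image_stdSimplex, image_image]
  exact (isCompact_stdSimplex ℝ ι).continuous_sInf (by fun_prop)

theorem isClosed_setOf_mem_convexHull_range [Finite ι] :
    IsClosed {p : E × (ι → E) | p.1 ∈ convexHull ℝ (range p.2)} := by
  cases isEmpty_or_nonempty ι
  · simp [range_eq_empty]
  · have hmem (p : E × (ι → E)) : p.1 ∈ convexHull ℝ (range p.2) ↔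
        infDist p.1 (convexHull ℝ (range p.2)) = 0 :=
      ((finite_range p.2).isClosed_convexHull ℝ).mem_iff_infDist_zero
        (range_nonempty p.2).convexHull
    simp_rw [hmem]
    exact isClosed_eq continuous_infDist_convexHull_range continuous_const

-- By Krein–Milman, a polytope is spanned by its vertices, which all belong to `s`.
theorem mem_extremePoints_convexHull_iff {s : Set E} (hs : s.Finite) {x : E} (hx : x ∈ s) :
    x ∈ (convexHull ℝ s).extremePoints ℝ ↔ x ∉ convexHull ℝ (s \ {x}) := by
  constructor
  · intro hext
    have hnot := ((convex_convexHull ℝ s).mem_extremePoints_iff_mem_sdiff_convexHull_sdiff.1 hext).2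
    exact fun hmem => hnot (convexHull_mono (sdiff_subset_sdiff_left (subset_convexHull ℝ s)) hmem)
  · contrapose!
    intro hext
    have hsub : (convexHull ℝ s).extremePoints ℝ ⊆ s \ {x} :=
      subset_sdiff_singleton extremePoints_convexHull_subset hext
    have hclosure := closure_convexHull_extremePoints (hs.isCompact_convexHull ℝ)
      (convex_convexHull ℝ s)
    rw [((hs.subset extremePoints_convexHull_subset).isClosed_convexHull ℝ).closure_eq] at hclosure
    exact convexHull_mono hsub (hclosure.symm ▸ subset_convexHull ℝ s hx)

theorem extremePoints_convexHull_range_of_injective {n : ℕ} {x : Fin (n + 1) → E}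
    (hx : Function.Injective x) :
    (convexHull ℝ (range x)).extremePoints ℝ =
      x '' {i | x i ∉ convexHull ℝ (range (i.removeNth x))} := by
  have hremove (i : Fin (n + 1)) : range x \ {x i} = range (i.removeNth x) := by
    rw [show i.removeNth x = x ∘ i.succAbove from rfl, range_comp, Fin.range_succAbove,
      image_compl_eq_range_sdiff_image hx, image_singleton]
  have hext (i : Fin (n + 1)) : x i ∈ (convexHull ℝ (range x)).extremePoints ℝ ↔
      x i ∉ convexHull ℝ (range (i.removeNth x)) := by
    rw [mem_extremePoints_convexHull_iff (finite_range x) (mem_range_self i), hremove]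
  rw [← inter_eq_right.2 (extremePoints_convexHull_subset (𝕜 := ℝ) (A := range x)),
    ← image_preimage_eq_range_inter]
  congr 1 with i
  exact hext i

end ConvexHull

section Caratheodory

open Module

variable {E : Type*} [AddCommGroup E] [Module ℝ E] [FiniteDimensional ℝ E]

theorem exists_finset_card_le_finrank_of_le_of_mem_convexHull {s : Set E} {p : E}
    {f : Dual ℝ E} (hf : f ≠ 0) (hle : ∀ v ∈ s, f v ≤ f p) (hp : p ∈ convexHull ℝ s) :
    ∃ t : Finset E, ↑t ⊆ s ∧ t.card ≤ finrank ℝ E ∧ p ∈ convexHull ℝ (t : Set E) := by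
  classical
  obtain ⟨κ, _, z, w, hzs, hindep, hwpos, hwsum, rfl⟩ := eq_pos_convex_span_of_mem_convexHull hp
  set p := ∑ k, w k • z k with hpdef
  have hzle (k : κ) : f (z k) ≤ f p := hle _ (hzs ⟨k, rfl⟩)
  have hzeq (k : κ) : f (z k) = f p := by
    have hsum : ∑ k, w k * f (z k) = ∑ k, w k * f p := by
      rw [← Finset.sum_mul, hwsum, one_mul, hpdef, map_sum]
      simp
    have := (Finset.sum_eq_sum_iff_of_le fun k _ =>
      mul_le_mul_of_nonneg_left (hzle k) (hwpos k).le).1 hsum k (Finset.mem_univ k)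
    exact mul_left_cancel₀ (hwpos k).ne' this
  have hspan : vectorSpan ℝ (Set.range z) ≤ LinearMap.ker f := by
    rw [vectorSpan_def, Submodule.span_le]
    rintro _ ⟨_, ⟨k, rfl⟩, _, ⟨l, rfl⟩, rfl⟩
    simp [hzeq]
  have hcard : Fintype.card κ ≤ finrank ℝ E :=
    (hindep.card_le_finrank_succ.trans (Nat.succ_le_succ (Submodule.finrank_mono hspan))).trans_eq
      (Dual.finrank_ker_add_one_of_ne_zero hf)
  refine ⟨Finset.univ.image z, by simpa using hzs, Finset.card_image_le.trans hcard, ?_⟩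
  exact (convex_convexHull ℝ _).sum_mem (fun k _ => (hwpos k).le) hwsum fun k _ =>
    subset_convexHull ℝ _ (by simp)

end Caratheodory

section NearestPoint

open Set Metric Module

variable {ι E : Type*} [NormedAddCommGroup E] [InnerProductSpace ℝ E]

theorem nonempty_of_infDist_pos {α : Type*} [PseudoMetricSpace α] {s : Set α} {x : α}
    (h : 0 < infDist x s) : s.Nonempty :=
  nonempty_iff_ne_empty.2 fun hs => h.ne' (hs ▸ infDist_empty)

theorem inner_sub_le_inner_sub_of_infDist_eq_dist {K : Set E} (hK : Convex ℝ K) {y p v : E}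
    (hp : p ∈ K) (hdist : infDist y K = dist y p) (hv : v ∈ K) :
    inner ℝ (y - p) v ≤ inner ℝ (y - p) p := by
  have hinf : ‖y - p‖ = ⨅ w : K, ‖y - w‖ := by
    simp_rw [← dist_eq_norm, ← hdist, infDist_eq_iInf]
  simpa [inner_sub_right] using (norm_eq_iInf_iff_real_inner_le_zero hK hp).1 hinf v hv

theorem exists_ne_zero_forall_infDist_le_imp_inner_lt {s : Set E} {y : E}
    (hs : IsCompact (convexHull ℝ s)) (hy : 0 < infDist y (convexHull ℝ s)) :
    ∃ a : E, a ≠ 0 ∧ ∀ v, infDist y (convexHull ℝ s) ≤ infDist y (convexHull ℝ (insert v s)) →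
      inner ℝ a v < inner ℝ a y := by
  have hne : (convexHull ℝ s).Nonempty := nonempty_of_infDist_pos hy
  obtain ⟨p, hp, hdist⟩ := hs.exists_infDist_eq_dist hne y
  have hyp : y - p ≠ 0 := sub_ne_zero.2 (dist_pos.1 (hdist ▸ hy))
  refine ⟨y - p, hyp, fun v hv => ?_⟩
  have hpv : p ∈ convexHull ℝ (insert v s) := convexHull_mono (subset_insert v s) hp
  have hdistv : infDist y (convexHull ℝ (insert v s)) = dist y p :=
    (infDist_le_dist_of_mem hpv).antisymm (hdist ▸ hv)
  calc inner ℝ (y - p) v ≤ inner ℝ (y - p) p :=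
        inner_sub_le_inner_sub_of_infDist_eq_dist (convex_convexHull ℝ _) hpv hdistv
          (subset_convexHull ℝ _ (mem_insert v s))
    _ < inner ℝ (y - p) y := by
        rw [← sub_pos, ← inner_sub_right]
        exact real_inner_self_pos.2 hyp

theorem exists_comp_infDist_convexHull_eq [FiniteDimensional ℝ E] [Finite ι]
    {x : ι → E} {y : E} (hy : 0 < infDist y (convexHull ℝ (range x))) :
    ∃ f : Fin (finrank ℝ E) → ι,
      infDist y (convexHull ℝ (range (x ∘ f))) = infDist y (convexHull ℝ (range x)) := by
  have hne := nonempty_of_infDist_pos hy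
  obtain ⟨p, hp, hdist⟩ :=
    ((finite_range x).isCompact_convexHull ℝ).exists_infDist_eq_dist hne y
  have hyp : innerₗ E (y - p) ≠ 0 := fun h =>
    sub_ne_zero.2 (dist_pos.1 (hdist ▸ hy)) (inner_self_eq_zero.1 (DFunLike.congr_fun h (y - p)))
  obtain ⟨t, htx, hcard, hpt⟩ := exists_finset_card_le_finrank_of_le_of_mem_convexHull hyp
    (fun v hv => inner_sub_le_inner_sub_of_infDist_eq_dist (convex_convexHull ℝ _) hp hdist
      (subset_convexHull ℝ _ hv)) hp
  have : Nonempty t := (convexHull_nonempty_iff.1 ⟨p, hpt⟩).to_subtype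
  obtain ⟨e⟩ : Nonempty (t ↪ Fin (finrank ℝ E)) :=
    Function.Embedding.nonempty_of_card_le (by simpa using hcard)
  choose g hg using fun v : t => htx v.2
  have hrange : range (x ∘ g ∘ Function.invFun e) = t := by
    rw [← Function.comp_assoc, (Function.invFun_surjective e.injective).range_comp,
      show x ∘ g = Subtype.val from funext hg, Subtype.range_val]
  refine ⟨g ∘ Function.invFun e, le_antisymm ?_ ?_⟩
  · rw [hrange, hdist]
    exact infDist_le_dist_of_mem hpt
  · rw [hrange]
    exact infDist_le_infDist_of_subset (convexHull_mono htx) ⟨p, hpt⟩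

/-- The pairs `(z, v)` such that `y` lies outside the polytope spanned by the points `z k`, and
adding the point `v` does not bring this polytope nearer to `y`. -/
def notNearer (κ : Type*) (y : E) : Set ((κ → E) × E) :=
  {p | 0 < infDist y (convexHull ℝ (range p.1)) ∧
    infDist y (convexHull ℝ (range p.1)) ≤ infDist y (convexHull ℝ (insert p.2 (range p.1)))}

theorem setOf_notMem_convexHull_range_subset [FiniteDimensional ℝ E] [Finite ι] [Nonempty ι]
    (y : E) :
    {x : ι → E | y ∉ convexHull ℝ (range x)} ⊆
      ⋃ f : Fin (finrank ℝ E) → ι, {x | ∀ j ∉ range f, (x ∘ f, x j) ∈ notNearer _ y} := by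
  intro x hx
  have hpos : 0 < infDist y (convexHull ℝ (range x)) :=
    (((finite_range x).isClosed_convexHull ℝ).notMem_iff_infDist_pos
      (range_nonempty x).convexHull).1 hx
  obtain ⟨f, hf⟩ := exists_comp_infDist_convexHull_eq hpos
  refine mem_iUnion.2 ⟨f, fun j _ => ⟨hf ▸ hpos, hf.trans_le ?_⟩⟩
  exact infDist_le_infDist_of_subset (convexHull_mono (insert_subset (mem_range_self j)
    (range_comp_subset_range f x))) (insert_nonempty _ _).convexHull

end NearestPoint

section PiMeasure

open Set

variable {ι κ α : Type*} [Fintype ι] [Fintype κ] [MeasurableSpace α]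

theorem pi_setOf_forall_notMem_range_le (μ : Measure α) [IsProbabilityMeasure μ] (f : κ → ι)
    {M : Set ((κ → α) × α)} (hM : MeasurableSet M) {q : ENNReal} (hq1 : q ≤ 1)
    (hq : ∀ z, μ (Prod.mk z ⁻¹' M) ≤ q) :
    (Measure.pi fun _ : ι => μ) {x | ∀ j ∉ range f, (x ∘ f, x j) ∈ M} ≤
      q ^ (Fintype.card ι - Fintype.card κ) := by
  classical
  let restr (u : range f → α) : κ → α := fun k => u ⟨f k, mem_range_self k⟩
  let B : Set ((range f → α) × ({i // i ∉ range f} → α)) := ⋂ j, {p | (restr p.1, p.2 j) ∈ M}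
  have hB : MeasurableSet B := .iInter fun j => hM.preimage (by fun_prop)
  have hpre : {x : ι → α | ∀ j ∉ range f, (x ∘ f, x j) ∈ M} =
      MeasurableEquiv.piEquivPiSubtypeProd (fun _ => α) (· ∈ range f) ⁻¹' B := by
    ext x
    simp only [B, mem_preimage, mem_iInter, Subtype.forall]
    rfl
  have hslice (u : range f → α) : Prod.mk u ⁻¹' B = univ.pi fun _ => Prod.mk (restr u) ⁻¹' M := by
    ext; simp [B]
  have hcard : Fintype.card ι - Fintype.card κ ≤ Fintype.card {i // i ∉ range f} := by
    rw [Fintype.card_subtype_compl]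
    exact Nat.sub_le_sub_left (Fintype.card_range_le f) _
  rw [hpre, (measurePreserving_piEquivPiSubtypeProd (fun _ => μ) (· ∈ range f)).measure_preimage
    hB.nullMeasurableSet, Measure.prod_apply hB]
  refine (lintegral_mono (g := fun _ => q ^ Fintype.card {i // i ∉ range f}) fun u => ?_).trans
    (by simpa using pow_le_pow_right_of_le_one' hq1 hcard)
  rw [hslice, Measure.pi_pi, Finset.prod_const, Finset.card_univ]
  exact pow_le_pow_left' (hq _) _

theorem measurePreserving_pi_pair (μ : ι → Measure α) [∀ i, IsProbabilityMeasure (μ i)]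
    {i j : ι} (hij : i ≠ j) :
    MeasurePreserving (fun x : ι → α => (x i, x j)) (Measure.pi μ) ((μ i).prod (μ j)) := by
  have hind : ProbabilityTheory.IndepFun (fun x : ι → α => x i) (fun x => x j) (Measure.pi μ) :=
    (ProbabilityTheory.iIndepFun_pi (X := fun _ => id) fun _ => aemeasurable_id).indepFun hij
  refine ⟨by fun_prop, ?_⟩
  rw [(ProbabilityTheory.indepFun_iff_map_prod_eq_prod_map_map
    (measurable_pi_apply i).aemeasurable (measurable_pi_apply j).aemeasurable).1 hind]
  exact congr_arg₂ _ (measurePreserving_eval μ i).map_eq (measurePreserving_eval μ j).map_eq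

theorem ae_injective_pi [MeasurableEq α] (μ : Measure α) [IsProbabilityMeasure μ]
    [NullSingletonClass μ] : ∀ᵐ x ∂Measure.pi (fun _ : ι => μ), Function.Injective x := by
  have hdiag : ∀ᵐ p ∂μ.prod μ, p ∉ diagonal α := by
    rw [← measure_eq_zero_iff_ae_notMem, Measure.measure_prod_null measurableSet_diagonal]
    exact .of_forall fun x => by simp [preimage]
  simp_rw [Function.injective_iff_pairwise_ne, Pairwise, eventually_all]
  exact fun i j hij => (measurePreserving_pi_pair (fun _ => μ) hij).quasiMeasurePreserving.ae hdiag

end PiMeasure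

section Markov

variable {α : Type*} [MeasurableSpace α] {μ : Measure α} {f : α → ℝ} {A : Set α} {δ : ℝ}

theorem mul_measureReal_le_integral [IsFiniteMeasure μ] (hf : Integrable f μ) (hf0 : 0 ≤ f)
    (hδ : 0 ≤ δ) (hA : ∀ x ∈ A, δ ≤ f x) : δ * μ.real A ≤ ∫ x, f x ∂μ :=
  calc δ * μ.real A ≤ δ * μ.real {x | δ ≤ f x} := by gcongr; exacts [measure_ne_top _ _, hA]
    _ ≤ ∫ x, f x ∂μ := mul_meas_ge_le_integral_of_nonneg (ae_of_all _ hf0) hf δ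

theorem integral_le_measureReal_add [IsProbabilityMeasure μ] (hf0 : 0 ≤ f) (hf1 : f ≤ 1)
    (hδ : 0 ≤ δ) (hA : ∀ x ∉ A, f x ≤ δ) : ∫ x, f x ∂μ ≤ μ.real A + δ := by
  set B := toMeasurable μ A
  have hB : MeasurableSet B := measurableSet_toMeasurable μ A
  have hB1 : Integrable (B.indicator fun _ => (1 : ℝ)) μ := (integrable_const _).indicator hB
  have hle (x : α) : f x ≤ B.indicator (fun _ => 1) x + δ := by
    by_cases hx : x ∈ B
    · simpa [hx] using (hf1 x).trans (le_add_of_nonneg_right hδ)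
    · simpa [hx] using hA x fun hxA => hx (subset_toMeasurable μ A hxA)
  calc ∫ x, f x ∂μ ≤ ∫ x, (B.indicator (fun _ => 1) x + δ) ∂μ :=
        integral_mono_of_nonneg (ae_of_all _ hf0) (hB1.add (integrable_const _)) (ae_of_all _ hle)
    _ = μ.real B + δ := by
        rw [integral_add hB1 (integrable_const _), integral_indicator_const _ hB]
        simp
    _ = μ.real A + δ := by rw [measureReal_def, measure_toMeasurable, measureReal_def]

end Markov

section OutsideProb

open Set Metric Module

variable {E : Type*} [NormedAddCommGroup E] [MeasurableSpace E]

/-- The probability that `y` is not in the convex hull of `N` independent points with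
distribution `μ`. -/
noncomputable def outsideProb [NormedSpace ℝ E] (μ : Measure E) (N : ℕ) (y : E) : ℝ :=
  (Measure.pi fun _ : Fin N => μ).real {x | y ∉ convexHull ℝ (range x)}

section NormedSpace

variable [NormedSpace ℝ E] (μ : Measure E) [IsProbabilityMeasure μ]

theorem outsideProb_le_one (N : ℕ) : outsideProb μ N ≤ 1 :=
  fun _ => measureReal_le_one

theorem measureReal_pow_le_outsideProb (N : ℕ) {K : Set E} (hK : Convex ℝ K) {y : E}
    (hy : y ∉ K) : μ.real K ^ N ≤ outsideProb μ N y :=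
  calc μ.real K ^ N = (Measure.pi fun _ : Fin N => μ).real (univ.pi fun _ => K) := by
        simp [measureReal_def, Measure.pi_pi]
    _ ≤ outsideProb μ N y := measureReal_mono fun x hx hmem =>
        hy (convexHull_min (range_subset_iff.2 fun i => hx i trivial) hK hmem)

theorem measurable_outsideProb [BorelSpace E] [SecondCountableTopology E] (N : ℕ) :
    Measurable (outsideProb μ N) :=
  (measurable_measure_prodMk_left
    isClosed_setOf_mem_convexHull_range.measurableSet.compl).ennreal_toReal

theorem integrable_outsideProb [BorelSpace E] [SecondCountableTopology E] (N : ℕ) :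
    Integrable (outsideProb μ N) μ :=
  .of_bound (measurable_outsideProb μ N).aestronglyMeasurable 1 <| ae_of_all _ fun y =>
    (Real.norm_of_nonneg measureReal_nonneg).trans_le (outsideProb_le_one μ N y)

end NormedSpace

variable [InnerProductSpace ℝ E]

theorem measure_prodMk_preimage_notNearer_le {κ : Type*} [Finite κ] {μ : Measure E} {y : E}
    {q : ENNReal} (hq : ∀ a ≠ 0, μ {v | inner ℝ a v < inner ℝ a y} ≤ q) (z : κ → E) :
    μ (Prod.mk z ⁻¹' notNearer κ y) ≤ q := by
  by_cases hz : 0 < infDist y (convexHull ℝ (range z))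
  · obtain ⟨a, ha, hlt⟩ := exists_ne_zero_forall_infDist_le_imp_inner_lt
      ((finite_range z).isCompact_convexHull ℝ) hz
    exact (measure_mono fun v hv => hlt v hv.2).trans (hq a ha)
  · simp [notNearer, hz]

variable [FiniteDimensional ℝ E] [BorelSpace E]

theorem measurableSet_notNearer (n : ℕ) (y : E) : MeasurableSet (notNearer (Fin n) y) := by
  have hinfDist {m : ℕ} {g : (Fin n → E) × E → Fin m → E} (hg : Continuous g) :
      Measurable fun p => infDist y (convexHull ℝ (range (g p))) :=
    (continuous_infDist_convexHull_range.comp (continuous_const.prodMk hg)).measurable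
  simp_rw [notNearer, ← Fin.range_cons]
  exact (measurableSet_lt measurable_const (hinfDist continuous_fst)).inter
    (measurableSet_le (hinfDist continuous_fst)
      (hinfDist (continuous_snd.finCons (A := fun _ => E) continuous_fst)))

-- If the polytope misses `y`, then `dim E` of the sample points determine an open halfspace with
-- `y` on its boundary which contains all the others: take the union bound over their choice.
theorem pi_setOf_notMem_convexHull_range_le {ι : Type*} [Fintype ι] [Nonempty ι] (μ : Measure E)
    [IsProbabilityMeasure μ] {y : E} {q : ENNReal} (hq1 : q ≤ 1)
    (hq : ∀ a ≠ 0, μ {v | inner ℝ a v < inner ℝ a y} ≤ q) :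
    (Measure.pi fun _ : ι => μ) {x | y ∉ convexHull ℝ (range x)} ≤
      Fintype.card ι ^ finrank ℝ E * q ^ (Fintype.card ι - finrank ℝ E) := by
  classical
  calc _ ≤ _ := measure_mono (setOf_notMem_convexHull_range_subset y)
    _ ≤ ∑ f : Fin (finrank ℝ E) → ι, (Measure.pi fun _ : ι => μ)
          {x | ∀ j ∉ range f, (x ∘ f, x j) ∈ notNearer _ y} := measure_iUnion_fintype_le _ _
    _ ≤ ∑ _ : Fin (finrank ℝ E) → ι, q ^ (Fintype.card ι - finrank ℝ E) := by
        gcongr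
        simpa only [Fintype.card_fin] using pi_setOf_forall_notMem_range_le μ _
          (measurableSet_notNearer _ y) hq1 (measure_prodMk_preimage_notNearer_le hq)
    _ = _ := by simp

end OutsideProb

section EfronIdentity

open Set

section NormedSpace

variable {E : Type*} [NormedAddCommGroup E] [NormedSpace ℝ E]

/-- The event that the sample point `x i` is outside the polytope spanned by the other sample
points. -/
def vertexEvent {N : ℕ} (i : Fin (N + 1)) : Set (Fin (N + 1) → E) :=
  {x | x i ∉ convexHull ℝ (range (i.removeNth x))}

variable [MeasurableSpace E] [BorelSpace E] [SecondCountableTopology E] {N : ℕ}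

theorem measurableSet_vertexEvent (i : Fin (N + 1)) :
    MeasurableSet (vertexEvent i : Set (Fin (N + 1) → E)) :=
  isClosed_setOf_mem_convexHull_range.measurableSet.compl.preimage
    (MeasurableEquiv.piFinSuccAbove (fun _ => E) i).measurable

theorem measureReal_vertexEvent (μ : Measure E) [IsProbabilityMeasure μ] (i : Fin (N + 1)) :
    (Measure.pi fun _ => μ).real (vertexEvent i) = ∫ y, outsideProb μ N y ∂μ := by
  have hmeas : MeasurableSet {p : E × (Fin N → E) | p.1 ∉ convexHull ℝ (range p.2)} :=
    isClosed_setOf_mem_convexHull_range.measurableSet.compl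
  calc (Measure.pi fun _ => μ).real (vertexEvent i)
      = (μ.prod (Measure.pi fun _ => μ)).real {p | p.1 ∉ convexHull ℝ (range p.2)} :=
        (measurePreserving_piFinSuccAbove (fun _ => μ) i).measureReal_preimage
          hmeas.nullMeasurableSet
    _ = ∫ y, outsideProb μ N y ∂μ := by
        rw [measureReal_def, Measure.prod_apply hmeas]
        exact (integral_toReal (measurable_measure_prodMk_left hmeas).aemeasurable
          (ae_of_all _ fun y => measure_lt_top _ _)).symm

end NormedSpace

variable {d N : ℕ}

theorem numVertices_samplePolytope_of_injective {x : Fin (N + 1) → EuclideanSpace ℝ (Fin d)}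
    (hx : Function.Injective x) :
    (numVertices (samplePolytope x) : ℝ) = ∑ i, (vertexEvent i).indicator (fun _ => 1) x := by
  classical
  calc (numVertices (samplePolytope x) : ℝ) = ({i | x ∈ vertexEvent i}.ncard : ℝ) := by
        rw [numVertices, samplePolytope, extremePoints_convexHull_range_of_injective hx,
          ncard_image_of_injective _ hx]
        rfl
    _ = ∑ i, (vertexEvent i).indicator (fun _ => 1) x := by
        simp [indicator_apply, ncard_eq_toFinset_card']

variable (μ : Measure (EuclideanSpace ℝ (Fin d))) [IsProbabilityMeasure μ]

instance isProbabilityMeasure_sampleLaw (n : ℕ) : IsProbabilityMeasure (sampleLaw μ n) :=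
  inferInstanceAs (IsProbabilityMeasure (Measure.pi fun _ => μ))

theorem integrable_indicator_vertexEvent (i : Fin (N + 1)) :
    Integrable ((vertexEvent i).indicator fun _ => (1 : ℝ)) (sampleLaw μ (N + 1)) :=
  (integrable_const _).indicator (measurableSet_vertexEvent i)

variable [NullSingletonClass μ]

theorem numVertices_samplePolytope_ae_eq (N : ℕ) :
    (fun x => (numVertices (samplePolytope x) : ℝ)) =ᵐ[sampleLaw μ (N + 1)]
      fun x => ∑ i, (vertexEvent i).indicator (fun _ => 1) x := by
  filter_upwards [ae_injective_pi μ] with x hx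
  exact numVertices_samplePolytope_of_injective hx

theorem integrable_numVertices_samplePolytope (N : ℕ) :
    Integrable (fun x => (numVertices (samplePolytope x) : ℝ)) (sampleLaw μ (N + 1)) :=
  (integrable_congr (numVertices_samplePolytope_ae_eq μ N)).2
    (integrable_finsetSum _ fun i _ => integrable_indicator_vertexEvent μ i)

theorem expectedVertices_succ (N : ℕ) :
    expectedVertices μ (N + 1) = (N + 1) * ∫ y, outsideProb μ N y ∂μ := by
  calc expectedVertices μ (N + 1)
      = ∑ i : Fin (N + 1), ∫ x, (vertexEvent i).indicator (fun _ => (1 : ℝ)) x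
          ∂sampleLaw μ (N + 1) := by
        rw [expectedVertices, integral_congr_ae (numVertices_samplePolytope_ae_eq μ N),
          integral_finsetSum _ fun i _ => integrable_indicator_vertexEvent μ i]
    _ = ∑ i : Fin (N + 1), (sampleLaw μ (N + 1)).real (vertexEvent i) := by
        simp [integral_indicator_const _ (measurableSet_vertexEvent _)]
    _ = (N + 1) * ∫ y, outsideProb μ N y ∂μ := by
        simp [sampleLaw, measureReal_vertexEvent]

end EfronIdentity

section WetPart

variable {d : ℕ} {μ : Measure (EuclideanSpace ℝ (Fin d))} {y : EuclideanSpace ℝ (Fin d)} {t : ℝ}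

theorem IsClosedHalfspace.measurableSet {h : Set (EuclideanSpace ℝ (Fin d))}
    (hh : IsClosedHalfspace h) : MeasurableSet h := by
  obtain ⟨a, -, c, rfl⟩ := hh
  exact measurableSet_le measurable_const (by fun_prop)

theorem IsClosedHalfspace.convex_compl {h : Set (EuclideanSpace ℝ (Fin d))}
    (hh : IsClosedHalfspace h) : Convex ℝ hᶜ := by
  obtain ⟨a, -, c, rfl⟩ := hh
  simpa [Set.compl_ofPred] using convex_halfSpace_lt (innerₗ _ a).isLinear c

variable [IsProbabilityMeasure μ]

theorem pow_le_outsideProb_of_mem_wetPart (N : ℕ) (ht : t ≤ 1) (hy : y ∈ wetPart μ t) :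
    (1 - t) ^ N ≤ outsideProb μ N y := by
  obtain ⟨h, hh, hyh, hμh⟩ := hy
  calc (1 - t) ^ N ≤ μ.real hᶜ ^ N := by
        rw [probReal_compl_eq_one_sub hh.measurableSet]
        gcongr
    _ ≤ outsideProb μ N y := measureReal_pow_le_outsideProb μ N hh.convex_compl (by simpa)

theorem outsideProb_le_of_notMem_wetPart (N : ℕ) (ht : 0 ≤ t) (hy : y ∉ wetPart μ t) :
    outsideProb μ N y ≤ (N + 1) ^ d * Real.exp (-t) ^ (N - d) := by
  rcases eq_or_ne N 0 with rfl | hN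
  · simp [outsideProb]
  have : NeZero N := ⟨hN⟩
  set q : ENNReal := ENNReal.ofReal (Real.exp (-t)) with hq
  have hq1 : q ≤ 1 := by simpa [hq] using ht
  have hhalf (a : EuclideanSpace ℝ (Fin d)) (ha : a ≠ 0) :
      μ {v | inner ℝ a v < inner ℝ a y} ≤ q := by
    have hh : IsClosedHalfspace {v | inner ℝ a y ≤ inner ℝ a v} := ⟨a, ha, _, rfl⟩
    have hμh : t < μ.real {v | inner ℝ a y ≤ inner ℝ a v} :=
      not_le.1 fun hle => hy ⟨_, hh, le_refl (inner ℝ a y), hle⟩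
    have hcompl := probReal_compl_eq_one_sub (μ := μ) hh.measurableSet
    rw [show {v | inner ℝ a v < inner ℝ a y} = {v | inner ℝ a y ≤ inner ℝ a v}ᶜ by
      ext; simp, ← ofReal_measureReal, hcompl]
    exact ENNReal.ofReal_le_ofReal (by linarith [Real.add_one_le_exp (-t)])
  refine ENNReal.toReal_le_of_le_ofReal (by positivity) ?_
  calc _ ≤ (N : ENNReal) ^ d * q ^ (N - d) := by
        simpa using pi_setOf_notMem_convexHull_range_le (ι := Fin N) μ hq1 hhalf
    _ = ENNReal.ofReal (N ^ d * Real.exp (-t) ^ (N - d)) := by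
        rw [ENNReal.ofReal_mul (by positivity), ENNReal.ofReal_pow (by positivity),
          ENNReal.ofReal_natCast, ENNReal.ofReal_pow (by positivity)]
    _ ≤ ENNReal.ofReal ((N + 1) ^ d * Real.exp (-t) ^ (N - d)) := by
        gcongr
        linarith

end WetPart

section VertexBounds

theorem inv_exp_one_le_one_sub_inv_pow (N : ℕ) :
    1 / Real.exp 1 ≤ (1 - 1 / ((N : ℝ) + 1)) ^ N := by
  rcases eq_or_ne N 0 with rfl | hN
  · simpa using inv_le_one_of_one_le₀ (Real.one_le_exp zero_le_one)
  have hinv : 1 - 1 / ((N : ℝ) + 1) = (1 + (N : ℝ)⁻¹)⁻¹ := by field_simp; ring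
  rw [hinv, inv_pow, one_div]
  exact inv_anti₀ (by positivity) Real.one_add_inv_pow_le_exp

/-- The error term `ε_d(n)` of the upper bound on the expected number of vertices. -/
noncomputable def vertexError (d n : ℕ) : ℝ :=
  n ^ (d + 1) * Real.exp (-((d + 2) * (Real.log n / n))) ^ (n - 1 - d)

theorem vertexError_eq {d n : ℕ} (hn : d + 1 ≤ n) :
    vertexError d n = Real.exp ((d + 2) * (d + 1) * (Real.log n / n)) * (n : ℝ)⁻¹ := by
  have hn0 : (0 : ℝ) < n := by exact_mod_cast (Nat.succ_pos d).trans_le hn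
  have hpow : (n : ℝ) ^ (d + 1) = Real.exp ((d + 1) * Real.log n) := by
    rw [← Real.exp_log hn0, ← Real.exp_nat_mul]
    simp
  have hinv : (n : ℝ)⁻¹ = Real.exp (-Real.log n) := by rw [Real.exp_neg, Real.exp_log hn0]
  rw [vertexError, hpow, hinv, ← Real.exp_nat_mul, ← Real.exp_add, ← Real.exp_add, Nat.sub_sub,
    Nat.cast_sub (by omega)]
  congr 1
  field_simp
  push_cast
  ring

theorem tendsto_vertexError (d : ℕ) : Tendsto (vertexError d) atTop (𝓝 0) := by
  have hlog : Tendsto (fun n : ℕ => Real.log n / n) atTop (𝓝 0) :=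
    Real.isLittleO_log_id_atTop.tendsto_div_nhds_zero.comp tendsto_natCast_atTop_atTop
  have hexp : Tendsto (fun n : ℕ => Real.exp ((d + 2) * (d + 1) * (Real.log n / n))) atTop
      (𝓝 1) := by
    simpa using (hlog.const_mul ((d + 2) * (d + 1) : ℝ)).rexp
  have hprod := hexp.mul tendsto_inv_atTop_nhds_zero_nat
  rw [mul_zero] at hprod
  refine hprod.congr' ?_
  filter_upwards [eventually_ge_atTop (d + 1)] with n hn
  exact (vertexError_eq hn).symm

variable {d : ℕ} (μ : Measure (EuclideanSpace ℝ (Fin d))) [IsProbabilityMeasure μ]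
  [NullSingletonClass μ]

theorem mul_wetMeasure_le_expectedVertices {n : ℕ} (hn : 1 ≤ n) :
    1 / Real.exp 1 * n * wetMeasure μ (1 / n) ≤ expectedVertices μ n := by
  obtain ⟨N, rfl⟩ := Nat.exists_eq_add_one.2 hn
  rw [expectedVertices_succ, Nat.cast_succ, mul_right_comm, mul_comm]
  gcongr
  refine mul_measureReal_le_integral (integrable_outsideProb μ N) (fun y => measureReal_nonneg)
    (by positivity) fun y hy => ?_
  exact (inv_exp_one_le_one_sub_inv_pow N).trans
    (pow_le_outsideProb_of_mem_wetPart N (div_le_one_of_le₀ (by simp) (by positivity)) hy)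

theorem expectedVertices_le_mul_wetMeasure_add {n : ℕ} (hn : 1 ≤ n) :
    expectedVertices μ n ≤ n * wetMeasure μ ((d + 2) * (Real.log n / n)) + vertexError d n := by
  obtain ⟨N, rfl⟩ := Nat.exists_eq_add_one.2 hn
  set t : ℝ := (d + 2) * (Real.log (N + 1 : ℕ) / (N + 1 : ℕ)) with ht
  have ht0 : 0 ≤ t := by positivity
  set δ : ℝ := (N + 1) ^ d * Real.exp (-t) ^ (N - d)
  have herror : vertexError d (N + 1) = (N + 1) * δ := by
    rw [vertexError, ← ht, Nat.cast_succ, pow_succ', mul_assoc, Nat.add_sub_cancel]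
  have houtside : ∫ y, outsideProb μ N y ∂μ ≤ wetMeasure μ t + δ :=
    integral_le_measureReal_add (fun y => measureReal_nonneg) (outsideProb_le_one μ N)
      (by positivity) fun y hy => outsideProb_le_of_notMem_wetPart N ht0 hy
  rw [expectedVertices_succ, herror, Nat.cast_succ, ← mul_add]
  gcongr

end VertexBounds

section SphereMeasure

open Set Metric Module Measure
open scoped Pointwise

variable {E : Type*} [NormedAddCommGroup E] [InnerProductSpace ℝ E] {r : ℝ}

theorem ball_subset_Ioo_smul_cap (hr : 0 < r) {a : E} (ha : a ≠ 0) {c : ℝ}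
    (hc : c ≤ r / 2 * ‖a‖) :
    ball ((3 / 4 * ‖a‖⁻¹) • a) (1 / 4) ⊆
      Ioo (0 : ℝ) 1 • (Subtype.val '' {x : sphere (0 : E) 1 | c ≤ inner ℝ a (r • (x : E))}) := by
  intro z hz
  have ha' : 0 < ‖a‖ := norm_pos_iff.2 ha
  set u : E := (3 / 4 * ‖a‖⁻¹) • a with hu
  have hzu : ‖z - u‖ < 1 / 4 := mem_ball_iff_norm.1 hz
  have hnorm : ‖u‖ = 3 / 4 := by
    rw [hu, norm_smul, Real.norm_of_nonneg (by positivity)]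
    field_simp
  have hau : inner ℝ a u = 3 / 4 * ‖a‖ := by
    rw [hu, inner_smul_right, real_inner_self_eq_norm_sq]
    field_simp
  have hz1 : ‖z‖ < 1 := by linarith [norm_le_norm_add_norm_sub u z, norm_sub_rev u z]
  have hz0 : 0 < ‖z‖ := by linarith [norm_le_norm_add_norm_sub z u]
  have haz : ‖a‖ / 2 ≤ inner ℝ a z := by
    have hsplit : inner ℝ a z = inner ℝ a u + inner ℝ a (z - u) := by rw [inner_sub_right]; ring
    nlinarith [neg_le_of_abs_le (abs_real_inner_le_norm a (z - u))]
  refine ⟨‖z‖, ⟨hz0, hz1⟩, ‖z‖⁻¹ • z,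
    ⟨⟨‖z‖⁻¹ • z, by simp [norm_smul, hz0.ne']⟩, ?_, rfl⟩, smul_inv_smul₀ hz0.ne' z⟩
  calc c ≤ r * (‖a‖ / 2) := by linarith
    _ ≤ r * inner ℝ a z := by gcongr
    _ ≤ r * (‖z‖⁻¹ * inner ℝ a z) := by
        gcongr
        exact le_mul_of_one_le_left (by linarith) ((one_le_inv₀ hz0).2 hz1.le)
    _ = inner ℝ a (r • ‖z‖⁻¹ • z) := by rw [inner_smul_right, inner_smul_right]

variable [MeasurableSpace E] [BorelSpace E] [FiniteDimensional ℝ E]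

/-- The uniform distribution on the sphere of radius `r` around `0`. -/
noncomputable def sphereMeasure (r : ℝ) : Measure E :=
  (ProbabilityTheory.cond (volume : Measure E).toSphere univ).map
    fun x : sphere (0 : E) 1 => r • (x : E)

instance isProbabilityMeasure_sphereMeasure [Nontrivial E] :
    IsProbabilityMeasure (sphereMeasure r : Measure E) := by
  have : IsProbabilityMeasure (ProbabilityTheory.cond (volume : Measure E).toSphere univ) :=
    ProbabilityTheory.cond_isProbabilityMeasure <|
      (measure_univ_pos.2 (toSphere_ne_zero _)).ne'
  exact isProbabilityMeasure_map (by fun_prop)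

theorem sphereMeasure_apply [Nontrivial E] {s : Set E} (hs : MeasurableSet s) :
    sphereMeasure r s = (volume (ball (0 : E) 1))⁻¹ *
      volume (Ioo (0 : ℝ) 1 • (Subtype.val '' {x : sphere (0 : E) 1 | r • (x : E) ∈ s})) := by
  have hmeas : Measurable fun x : sphere (0 : E) 1 => r • (x : E) := by fun_prop
  have hdim : (finrank ℝ E : ENNReal) ≠ 0 := by simpa using finrank_pos.ne'
  rw [sphereMeasure, map_apply hmeas hs, ProbabilityTheory.cond_apply .univ, univ_inter,
    toSphere_apply_univ, toSphere_apply' _ (hmeas hs),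
    ENNReal.mul_inv (.inl hdim) (.inl (ENNReal.natCast_ne_top _)),
    mul_mul_mul_comm, ENNReal.inv_mul_cancel hdim (by simp), one_mul]
  rfl

theorem ae_norm_eq_sphereMeasure (hr : 0 ≤ r) : ∀ᵐ x : E ∂sphereMeasure r, ‖x‖ = r :=
  (ae_map_iff (by fun_prop) (measurableSet_eq_fun measurable_norm measurable_const)).2 <|
    ae_of_all _ fun x => by
      rw [norm_smul, Real.norm_of_nonneg hr, norm_eq_of_mem_sphere, mul_one]

theorem sphereMeasure_singleton (hE : 1 < finrank ℝ E) (hr : r ≠ 0) (y : E) :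
    sphereMeasure r {y} = 0 := by
  have : Nontrivial E := nontrivial_of_finrank_pos (zero_lt_one.trans hE)
  have hspan : Submodule.span ℝ {y} ≠ ⊤ := fun htop => by
    have hle := finrank_span_le_card (R := ℝ) {y}
    rw [htop, finrank_top, toFinset_singleton, Finset.card_singleton] at hle
    exact hle.not_gt hE
  rw [sphereMeasure_apply (measurableSet_singleton y)]
  refine mul_eq_zero_of_right _ (measure_mono_null ?_ (addHaar_submodule volume _ hspan))
  rintro _ ⟨t, -, _, ⟨x, rfl, rfl⟩, rfl⟩
  exact Submodule.mem_span_singleton.2 ⟨t / r, by simp [smul_smul, div_mul_cancel₀ _ hr]⟩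

theorem sphereMeasure_setOf_norm_sq_le_inner (hE : 1 < finrank ℝ E) (hr : 0 < r) {y : E}
    (hy : r ≤ ‖y‖) : sphereMeasure r {z | ‖y‖ ^ 2 ≤ inner ℝ y z} = 0 := by
  refine measure_mono_null_ae ?_ (sphereMeasure_singleton hE hr.ne' y)
  filter_upwards [ae_norm_eq_sphereMeasure hr.le] with z hz hyz
  have hsq : ‖y - z‖ ^ 2 ≤ 0 := by
    have hyz : ‖y‖ ^ 2 ≤ inner ℝ y z := hyz
    rw [norm_sub_sq_real, hz]
    nlinarith
  have : ‖y - z‖ = 0 := by nlinarith [norm_nonneg (y - z)]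
  exact (sub_eq_zero.1 (norm_eq_zero.1 this)).symm

theorem quarter_pow_finrank_le_sphereMeasure (hr : 0 < r) {a : E} (ha : a ≠ 0) {c : ℝ}
    (hc : c ≤ r / 2 * ‖a‖) :
    ENNReal.ofReal ((1 / 4) ^ finrank ℝ E) ≤ sphereMeasure r {x : E | c ≤ inner ℝ a x} := by
  have : Nontrivial E := ⟨a, 0, ha⟩
  rw [sphereMeasure_apply (measurableSet_le measurable_const (by fun_prop))]
  calc _ = (volume (ball (0 : E) 1))⁻¹ * volume (ball ((3 / 4 * ‖a‖⁻¹) • a) (1 / 4)) := by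
        rw [addHaar_ball _ ((3 / 4 * ‖a‖⁻¹) • a) (by norm_num : (0 : ℝ) ≤ 1 / 4), mul_comm,
          mul_assoc,
          ENNReal.mul_inv_cancel (measure_ball_pos _ _ one_pos).ne' measure_ball_lt_top.ne,
          mul_one]
    _ ≤ _ := by
        gcongr
        exact ball_subset_Ioo_smul_cap hr ha hc

end SphereMeasure

section NestedSpheres

open Module

/-- The exponents of the masses `tailMass`. The recursion makes `tailMass d (i + 1)` a quarter of
the inverse of `sampleSize d i`. -/
def tailExponent (d : ℕ) : ℕ → ℕ
  | 0 => 0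
  | i + 1 => 2 * (tailExponent d i + 2 * d + 3)

/-- The mass which `nestedSpheres d` gives to the spheres of index at least `i` together. -/
noncomputable def tailMass (d i : ℕ) : ℝ := (1 / 2) ^ tailExponent d i

/-- The mass which `nestedSpheres d` gives to the sphere of radius `2 ^ i`. -/
noncomputable def sphereMass (d i : ℕ) : ℝ := tailMass d i - tailMass d (i + 1)

/-- A sample size for which most samples from `nestedSpheres d` have no point beyond the sphere of
radius `2 ^ i`, while every halfspace meeting the ball of radius `2 ^ i / 2` is heavy. -/
def sampleSize (d i : ℕ) : ℕ := 4 ^ (tailExponent d i + 2 * d + 2)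

variable (d : ℕ)

theorem strictMono_tailExponent : StrictMono (tailExponent d) :=
  strictMono_nat_of_lt_succ fun i => by simp only [tailExponent]; omega

theorem injective_sampleSize : Function.Injective (sampleSize d) := fun i j hij => by
  have := Nat.pow_right_injective (by norm_num) hij
  exact (strictMono_tailExponent d).injective (by omega)

variable (i : ℕ)

theorem sampleSize_pos : 0 < sampleSize d i := by
  unfold sampleSize; positivity

theorem tailMass_pos : 0 < tailMass d i := by
  unfold tailMass; positivity

theorem tailMass_le_one : tailMass d i ≤ 1 :=
  pow_le_one₀ (by norm_num) (by norm_num)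

theorem tailMass_succ_le_half : tailMass d (i + 1) ≤ tailMass d i / 2 :=
  calc tailMass d (i + 1) ≤ (1 / 2) ^ (tailExponent d i + 1) :=
        pow_le_pow_of_le_one (by norm_num) (by norm_num) (strictMono_tailExponent d i.lt_succ_self)
    _ = tailMass d i / 2 := by rw [tailMass, pow_succ]; ring

theorem tendsto_tailMass : Tendsto (tailMass d) atTop (𝓝 0) :=
  (tendsto_pow_atTop_nhds_zero_of_lt_one (by norm_num) (by norm_num)).comp
    (strictMono_tailExponent d).tendsto_atTop

theorem half_tailMass_le_sphereMass : tailMass d i / 2 ≤ sphereMass d i := by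
  have := tailMass_succ_le_half d i
  unfold sphereMass
  linarith

theorem sphereMass_pos : 0 < sphereMass d i :=
  (half_pos (tailMass_pos d i)).trans_le (half_tailMass_le_sphereMass d i)

theorem tsum_ofReal_sphereMass (k : ℕ) :
    ∑' i, ENNReal.ofReal (sphereMass d (i + k)) = ENNReal.ofReal (tailMass d k) := by
  have hnonneg (i : ℕ) : 0 ≤ sphereMass d (i + k) := (sphereMass_pos d _).le
  have hsum : HasSum (fun i => sphereMass d (i + k)) (tailMass d k) := by
    have hpartial (n : ℕ) :
        ∑ i ∈ Finset.range n, sphereMass d (i + k) = tailMass d k - tailMass d (n + k) := by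
      simpa [sphereMass, add_right_comm] using
        Finset.sum_range_sub' (fun i => tailMass d (i + k)) n
    simp_rw [hasSum_iff_tendsto_nat_of_nonneg hnonneg, hpartial]
    simpa using ((tendsto_add_atTop_iff_nat k).2 (tendsto_tailMass d)).const_sub (tailMass d k)
  rw [← hsum.tsum_eq, ENNReal.ofReal_tsum_of_nonneg hnonneg hsum.summable]

theorem sampleSize_mul_tailMass_succ : sampleSize d i * tailMass d (i + 1) = 1 / 4 := by
  rw [sampleSize, tailMass, tailExponent, pow_mul, pow_succ _ (_ + 2), Nat.cast_pow, ← mul_assoc,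
    ← mul_pow]
  norm_num

theorem logb_sampleSize_div_lt :
    Real.logb 2 (sampleSize d i) / sampleSize d i < sphereMass d i * (1 / 4) ^ d := by
  set m : ℕ := tailExponent d i + 2 * d + 2 with hm
  have hsize : (sampleSize d i : ℝ) = (2 ^ m) ^ 2 := by
    rw [sampleSize, ← hm, ← pow_mul, mul_comm, pow_mul]
    norm_num
  have hlog : Real.logb 2 (sampleSize d i) = 2 * m := by
    rw [hsize, ← pow_mul, Real.logb_pow, Real.logb_self_eq_one one_lt_two]
    push_cast
    ring
  have hmass : tailMass d i / 2 * (1 / 4) ^ d = 2 / 2 ^ m := by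
    rw [tailMass, hm, show (4 : ℝ) = 2 ^ 2 by norm_num, pow_add, pow_add, pow_mul, one_div_pow,
      one_div_pow]
    field_simp
  have hlt : (m : ℝ) < 2 ^ m := by exact_mod_cast Nat.lt_two_pow_self
  calc Real.logb 2 (sampleSize d i) / sampleSize d i < 2 * 2 ^ m / (2 ^ m) ^ 2 := by
        rw [hlog, hsize]
        gcongr
    _ = tailMass d i / 2 * (1 / 4) ^ d := by rw [hmass]; field_simp
    _ ≤ sphereMass d i * (1 / 4) ^ d := by
        gcongr
        exact half_tailMass_le_sphereMass d i

/-- The counterexample measure: a mixture of uniform distributions on concentric spheres, with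
masses so small that the spheres beyond the `i`-th one are negligible at its own scale. -/
noncomputable def nestedSpheres : Measure (EuclideanSpace ℝ (Fin d)) :=
  Measure.sum fun i => ENNReal.ofReal (sphereMass d i) • sphereMeasure (2 ^ i)

theorem nestedSpheres_apply (s : Set (EuclideanSpace ℝ (Fin d))) :
    nestedSpheres d s = ∑' i, ENNReal.ofReal (sphereMass d i) * sphereMeasure (2 ^ i) s := by
  simp [nestedSpheres, Measure.sum_apply_of_countable]

theorem ae_exists_norm_eq_nestedSpheres : ∀ᵐ x ∂nestedSpheres d, ∃ j : ℕ, ‖x‖ = 2 ^ j :=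
  Measure.ae_sum_iff.2 fun j => Measure.ae_smul_measure
    ((ae_norm_eq_sphereMeasure (by positivity)).mono fun _ hx => ⟨j, hx⟩) _

variable [d.AtLeastTwo]

theorem one_lt_finrank_euclideanSpace : 1 < finrank ℝ (EuclideanSpace ℝ (Fin d)) := by
  simpa using Nat.AtLeastTwo.one_lt

instance isProbabilityMeasure_nestedSpheres : IsProbabilityMeasure (nestedSpheres d) :=
  ⟨by simpa [nestedSpheres_apply, tailMass, tailExponent] using tsum_ofReal_sphereMass d 0⟩

instance nullSingletonClass_nestedSpheres : NullSingletonClass (nestedSpheres d) :=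
  ⟨fun x => by
    simp [nestedSpheres_apply, sphereMeasure_singleton (one_lt_finrank_euclideanSpace d)]⟩

variable {d i} {s : Set (EuclideanSpace ℝ (Fin d))}

theorem nestedSpheres_real_le_tailMass {k : ℕ} (hs : ∀ i < k, sphereMeasure (2 ^ i) s = 0) :
    (nestedSpheres d).real s ≤ tailMass d k := by
  refine ENNReal.toReal_le_of_le_ofReal (tailMass_pos d k).le ?_
  rw [nestedSpheres_apply, ← Summable.sum_add_tsum_nat_add' (k := k) ENNReal.summable,
    ← tsum_ofReal_sphereMass d k, Finset.sum_eq_zero fun i hi => ?_, zero_add]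
  · exact ENNReal.tsum_le_tsum fun i => mul_le_of_le_one_right' prob_le_one
  · rw [hs i (Finset.mem_range.1 hi), mul_zero]

theorem sphereMass_mul_le_nestedSpheres_real {c : ℝ}
    (hc : ENNReal.ofReal c ≤ sphereMeasure (2 ^ i) s) :
    sphereMass d i * c ≤ (nestedSpheres d).real s := by
  rw [measureReal_def, ← ENNReal.ofReal_le_iff_le_toReal (measure_ne_top _ _),
    nestedSpheres_apply, ENNReal.ofReal_mul (sphereMass_pos d i).le]
  refine le_trans ?_ (ENNReal.le_tsum i)
  gcongr

theorem nestedSpheres_real_setOf_le_norm_pos :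
    0 < (nestedSpheres d).real {x | (2 : ℝ) ^ i ≤ ‖x‖} := by
  have hone : sphereMeasure (2 ^ i) {x : EuclideanSpace ℝ (Fin d) | (2 : ℝ) ^ i ≤ ‖x‖} = 1 :=
    (mem_ae_iff_prob_eq_one (measurableSet_le measurable_const measurable_norm)).1 <|
      (ae_norm_eq_sphereMeasure (by positivity)).mono fun x hx => hx.ge
  have hle := sphereMass_mul_le_nestedSpheres_real (c := 1) (ENNReal.ofReal_one.trans hone.symm).le
  exact (mul_pos (sphereMass_pos d i) one_pos).trans_le hle

theorem mem_wetPart_nestedSpheres {y : EuclideanSpace ℝ (Fin d)} (hy : (2 : ℝ) ^ i ≤ ‖y‖) :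
    y ∈ wetPart (nestedSpheres d) (tailMass d (i + 1)) := by
  have hy0 : y ≠ 0 := norm_pos_iff.1 (lt_of_lt_of_le (by positivity) hy)
  refine ⟨{z | ‖y‖ ^ 2 ≤ inner ℝ y z}, ⟨y, hy0, _, rfl⟩, by simp,
    nestedSpheres_real_le_tailMass fun j hj => ?_⟩
  refine sphereMeasure_setOf_norm_sq_le_inner (one_lt_finrank_euclideanSpace d) (by positivity)
    (le_trans ?_ hy)
  exact pow_le_pow_right₀ one_le_two (Nat.lt_succ_iff.1 hj)

theorem two_pow_le_norm_of_mem_wetPart {x : EuclideanSpace ℝ (Fin d)} {j : ℕ} {t : ℝ}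
    (ht : t < sphereMass d i * (1 / 4) ^ d) (hj : ‖x‖ = 2 ^ j)
    (hx : x ∈ wetPart (nestedSpheres d) t) : (2 : ℝ) ^ i ≤ ‖x‖ := by
  obtain ⟨_, ⟨a, ha, c, rfl⟩, hcx, hle⟩ := hx
  by_contra! hxi
  rw [hj] at hxi
  have hji : j + 1 ≤ i := (pow_lt_pow_iff_right₀ one_lt_two).1 hxi
  have hx2 : ‖x‖ ≤ 2 ^ i / 2 := by
    rw [hj, le_div_iff₀ two_pos, ← pow_succ]
    exact pow_le_pow_right₀ one_le_two hji
  have hc : c ≤ 2 ^ i / 2 * ‖a‖ :=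
    calc c ≤ ‖a‖ * ‖x‖ := le_trans hcx (real_inner_le_norm a x)
      _ ≤ 2 ^ i / 2 * ‖a‖ := by rw [mul_comm]; gcongr
  have hcap := quarter_pow_finrank_le_sphereMeasure (by positivity) ha hc
  rw [finrank_euclideanSpace_fin] at hcap
  exact (hle.trans_lt ht).not_ge (sphereMass_mul_le_nestedSpheres_real hcap)

theorem wetMeasure_nestedSpheres_le {t : ℝ} (ht : t < sphereMass d i * (1 / 4) ^ d) :
    wetMeasure (nestedSpheres d) t ≤ (nestedSpheres d).real {x | (2 : ℝ) ^ i ≤ ‖x‖} := by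
  refine ENNReal.toReal_mono (measure_ne_top _ _) (measure_mono_ae ?_)
  filter_upwards [ae_exists_norm_eq_nestedSpheres d] with x ⟨j, hj⟩ hx
  exact two_pow_le_norm_of_mem_wetPart ht hj hx

theorem three_quarters_le_outsideProb_nestedSpheres {N : ℕ} (hN : sampleSize d i = N + 1)
    {y : EuclideanSpace ℝ (Fin d)} (hy : (2 : ℝ) ^ i ≤ ‖y‖) :
    3 / 4 ≤ outsideProb (nestedSpheres d) N y := by
  have hmass := sampleSize_mul_tailMass_succ d i
  rw [hN, Nat.cast_succ] at hmass
  have hpos := tailMass_pos d (i + 1)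
  have hle := tailMass_le_one d (i + 1)
  calc (3 : ℝ) / 4 ≤ 1 + N * -tailMass d (i + 1) := by linarith
    _ ≤ (1 + -tailMass d (i + 1)) ^ N := one_add_mul_le_pow (by linarith) N
    _ ≤ outsideProb (nestedSpheres d) N y :=
      pow_le_outsideProb_of_mem_wetPart N hle (mem_wetPart_nestedSpheres hy)

theorem half_mul_wetMeasure_lt_expectedVertices {n : ℕ} (hn : n = sampleSize d i) :
    1 / 2 * n * wetMeasure (nestedSpheres d) (Real.logb 2 n / n) <
      expectedVertices (nestedSpheres d) n := by
  have hwet := wetMeasure_nestedSpheres_le (hn ▸ logb_sampleSize_div_lt d i)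
  have hV := nestedSpheres_real_setOf_le_norm_pos (d := d) (i := i)
  set V := (nestedSpheres d).real {x | (2 : ℝ) ^ i ≤ ‖x‖}
  obtain ⟨N, hN⟩ : ∃ N, n = N + 1 := Nat.exists_eq_add_one.2 (hn ▸ sampleSize_pos d i)
  have hn0 : (0 : ℝ) < n := by rw [hN]; positivity
  have hintegral : 3 / 4 * V ≤ ∫ y, outsideProb (nestedSpheres d) N y ∂nestedSpheres d :=
    mul_measureReal_le_integral (integrable_outsideProb _ N) (fun y => measureReal_nonneg)
      (by norm_num) fun y => three_quarters_le_outsideProb_nestedSpheres (hn ▸ hN)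
  calc _ ≤ 1 / 2 * n * V := by gcongr
    _ < n * (3 / 4 * V) := by nlinarith [mul_pos hn0 hV]
    _ ≤ n * ∫ y, outsideProb (nestedSpheres d) N y ∂nestedSpheres d := by gcongr
    _ = expectedVertices (nestedSpheres d) n := by
        rw [hN, expectedVertices_succ, Nat.cast_succ]

end NestedSpheres

theorem theorem4_general :
    (∀ d : ℕ, ∃ ε : ℕ → ℝ, Tendsto ε atTop (𝓝 0) ∧
      ∀ μ : Measure (EuclideanSpace ℝ (Fin d)), IsProbabilityMeasure μ → (∀ x, μ {x} = 0) →
        ∀ n : ℕ, 1 ≤ n →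
          Integrable (fun x : Fin n → EuclideanSpace ℝ (Fin d) =>
            (numVertices (samplePolytope x) : ℝ)) (sampleLaw μ n) ∧
          1 / Real.exp 1 * n * wetMeasure μ (1 / n) ≤ expectedVertices μ n ∧
          expectedVertices μ n ≤ n * wetMeasure μ ((d + 2) * (Real.log n / n)) + ε n) ∧
    (∀ d : ℕ, 2 ≤ d → ∃ ν : Measure (EuclideanSpace ℝ (Fin d)),
      IsProbabilityMeasure ν ∧ (∀ x, ν {x} = 0) ∧
      {n : ℕ | expectedVertices ν n >
        1 / 2 * n * wetMeasure ν (Real.logb 2 n / n)}.Infinite) := by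
  refine ⟨fun d => ⟨vertexError d, tendsto_vertexError d, fun μ _ hμ n hn => ?_⟩, fun d hd => ?_⟩
  · have : NullSingletonClass μ := ⟨hμ⟩
    refine ⟨?_, mul_wetMeasure_le_expectedVertices μ hn,
      expectedVertices_le_mul_wetMeasure_add μ hn⟩
    obtain ⟨N, rfl⟩ := Nat.exists_eq_add_one.2 hn
    exact integrable_numVertices_samplePolytope μ N
  · have : d.AtLeastTwo := ⟨hd⟩
    exact ⟨nestedSpheres d, inferInstance, measure_singleton,
      Set.infinite_of_injective_forall_mem (injective_sampleSize d) fun i =>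
        half_mul_wetMeasure_lt_expectedVertices rfl⟩

theorem theorem4 :
    (∀ d : ℕ, ∃ ε : ℕ → ℝ, Tendsto ε atTop (𝓝 0) ∧
      ∀ μ : Measure (EuclideanSpace ℝ (Fin d)), IsProbabilityMeasure μ → (∀ x, μ {x} = 0) →
        ∀ n : ℕ, 1 ≤ n →
          Integrable (fun x : Fin n → EuclideanSpace ℝ (Fin d) =>
            (numVertices (samplePolytope x) : ℝ)) (sampleLaw μ n) ∧
          1 / Real.exp 1 * n * wetMeasure μ (1 / n) ≤ expectedVertices μ n ∧
          expectedVertices μ n ≤ n * wetMeasure μ ((d + 2) * (Real.log n / n)) + ε n) ∧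
    (∃ ν : Measure (EuclideanSpace ℝ (Fin 2)), IsProbabilityMeasure ν ∧ (∀ x, ν {x} = 0) ∧
      {n : ℕ | expectedVertices ν n >
        1 / 2 * n * wetMeasure ν (Real.logb 2 n / n)}.Infinite) := by
  exact ⟨theorem4_general.1, theorem4_general.2 2 le_rfl⟩
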